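/- For a finite group $G$, let $$P(G)=\frac{|\{(g,h)\in G\times G : gh=hg\}|}{|G|^2}$$ denote its commuting probability. Let $(G_i)_{i=1}^\infty$ be a sequence of finite groups whose commuting probabilities are bounded away from zero, i.e. there is $\varepsilon>0$ with $P(G_i)\ge\varepsilon$ for all $i$. Then there exists a subsequence $(G_{n_i})_{i=1}^\infty$ whose commuting probabilities satisfy at least one of the following two properties: 1. The commuting probabilities $P(G_{n_i})$ are all equal to each other. 2. There exist a finite group $H$ and an integer $k\ge 2$ such that $P(G_{n_i})\to\frac1k P(H)$ as $i\to\infty$ and $P(G_{n_i})\ge\frac1k P(H)$ for all $i$. -/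

import Mathlib

open Filter Topology

universe u

/-! A commuting probability bounded below forces structure (P. M. Neumann,
`exists_normal_of_le_commProb`): there is a normal subgroup `A` of bounded index that centralizes
`⁅A, A⁆`, with `⁅A, A⁆` of bounded order. Along a nonprincipal ultrafilter, every bounded integer
attached to `G i` becomes constant.

Suppose `A` is abelian (`hasCommProbLimit_of_abelian`). The index |A : C_A(u)| depends only on the
coset of `u`, so it takes boundedly many values, each of which stays bounded or tends to infinity
along the ultrafilter. The elements with bounded value form a subgroup `F ≥ A`, of index `d` say.
Its center has bounded index, so P(F) has finitely many possible values and is constant along the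
ultrafilter. Elements outside `F` have classes of unbounded size and contribute o(1), so P(G) tends
to P(F)/d², and P(F)/d² ≤ P(G) always holds. If d = 1, then F = G and P(G) is constant.

In general, descend on the order of `⁅A, A⁆` (`commProb_le_or_exists_normal_lt`). Either `A` has a
subgroup of bounded index, normal in `G`, with smaller commutator subgroup; or, for almost all `u`
whose class modulo `⁅A, A⁆` is bounded, the commutators `⁅u, c⁆` fill `⁅A, A⁆`. Then the class of
`u` is the full preimage of its image, and P(G) = P(G/A')/|A'| + o(1) with A' = `⁅A, A⁆`, again
approached from above. The quotient G/A' falls under the abelian case, and `k` gains the factor |A'|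
≥ 2. -/

open scoped commutatorElement

/-! ### Elements with small conjugacy classes -/

section CentralizerIndex

variable {G : Type u} [Group G]

/-- The index of the centralizer of `x`, that is, the size of the conjugacy class of `x`. -/
noncomputable def centIndex (x : G) : ℕ := (Subgroup.centralizer ({x} : Set G)).index

theorem mem_centralizer_singleton {x y : G} :
    y ∈ Subgroup.centralizer ({x} : Set G) ↔ Commute x y := by
  simp [Subgroup.mem_centralizer_iff, Commute, SemiconjBy]

theorem centIndex_inv (x : G) : centIndex x⁻¹ = centIndex x := by
  unfold centIndex
  congr 1
  ext y
  simp [mem_centralizer_singleton]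

theorem card_centralizer_mul_centIndex (x : G) :
    Nat.card (Subgroup.centralizer ({x} : Set G)) * centIndex x = Nat.card G :=
  Subgroup.card_mul_index _

variable [Finite G]

theorem Subgroup.index_le_of_le {H K : Subgroup G} (h : H ≤ K) : K.index ≤ H.index :=
  Nat.le_of_dvd (Nat.pos_of_ne_zero Subgroup.FiniteIndex.index_ne_zero)
    (Subgroup.index_dvd_of_le h)

theorem centIndex_pos (x : G) : 0 < centIndex x :=
  Nat.pos_of_ne_zero Subgroup.FiniteIndex.index_ne_zero

theorem centIndex_mul_le (x y : G) : centIndex (x * y) ≤ centIndex x * centIndex y := by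
  refine le_trans (Subgroup.index_le_of_le ?_) Subgroup.index_inf_le
  intro z hz
  rw [Subgroup.mem_inf, mem_centralizer_singleton, mem_centralizer_singleton] at hz
  rw [mem_centralizer_singleton]
  exact hz.1.mul_left hz.2

theorem card_commute_eq_sum [Fintype G] :
    Nat.card {p : G × G // Commute p.1 p.2} =
      ∑ x : G, Nat.card (Subgroup.centralizer ({x} : Set G)) := by
  rw [← Nat.card_sigma]
  refine Nat.card_congr ⟨fun p => ⟨p.1.1, p.1.2, mem_centralizer_singleton.2 p.2⟩,
    fun s => ⟨(s.1, s.2.1), mem_centralizer_singleton.1 s.2.2⟩, fun p => rfl, fun s => rfl⟩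

/-- A group with commuting probability at least `ε` has many elements with small class. -/
theorem card_centIndex_le_ge {ε : ℝ} (hG : ε ≤ (commProb G : ℝ)) {n : ℕ} (hn : 2 ≤ ε * n) :
    ε / 2 * Nat.card G ≤ Nat.card {x : G // centIndex x ≤ n} := by
  classical
  have := Fintype.ofFinite G
  have hpos : (0 : ℝ) < Nat.card G := Nat.cast_pos.2 Nat.card_pos
  have hn0 : (0 : ℝ) < n := by
    rcases Nat.eq_zero_or_pos n with h | h
    · subst h; norm_num at hn
    · exact_mod_cast h
  have h1 : ε * (Nat.card G : ℝ) ^ 2 ≤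
      ∑ x : G, (Nat.card (Subgroup.centralizer ({x} : Set G)) : ℝ) := by
    have := hG
    rw [commProb_def, card_commute_eq_sum] at this
    push_cast at this
    rwa [le_div_iff₀ (by positivity)] at this
  -- Elements with classes larger than `n` contribute at most |G|²/n ≤ (ε/2)|G|² commuting pairs in
  -- total, so the small classes account for the other half of ε|G|².
  have h2 : ∀ x : G, (Nat.card (Subgroup.centralizer ({x} : Set G)) : ℝ) ≤
      (if centIndex x ≤ n then (Nat.card G : ℝ) else 0) + Nat.card G / n := by
    intro x
    have hx : (Nat.card (Subgroup.centralizer ({x} : Set G)) : ℝ) * centIndex x = Nat.card G := by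
      exact_mod_cast card_centralizer_mul_centIndex x
    split_ifs with h
    · have h1 : (1 : ℝ) ≤ centIndex x := by exact_mod_cast centIndex_pos x
      have : (0 : ℝ) ≤ Nat.card G / n := by positivity
      nlinarith [Nat.cast_nonneg (α := ℝ) (Nat.card (Subgroup.centralizer ({x} : Set G)))]
    · rw [zero_add, le_div_iff₀ hn0, ← hx]
      have : (n : ℝ) ≤ centIndex x := by exact_mod_cast (not_le.1 h).le
      gcongr
  have h3 := h1.trans (Finset.sum_le_sum fun x _ => h2 x)
  rw [Finset.sum_add_distrib, ← Finset.sum_filter, Finset.sum_const, Finset.sum_const,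
    nsmul_eq_mul, nsmul_eq_mul, Finset.card_univ, ← Nat.card_eq_fintype_card] at h3
  have h4 : Nat.card {x : G // centIndex x ≤ n} =
      (Finset.univ.filter fun x : G => centIndex x ≤ n).card := by
    rw [Nat.card_eq_fintype_card, Fintype.card_subtype]
  rw [h4]
  have h5 : (Nat.card G : ℝ) / n ≤ ε / 2 * Nat.card G := by
    rw [div_le_iff₀ hn0]
    nlinarith
  refine le_of_mul_le_mul_right ?_ hpos
  nlinarith

/-- If the elements of class size at most `n ^ 2` are not closed under products, then
there are at least twice as many elements of class size at most `n ^ 5` as of size at most `n`. -/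
theorem two_mul_card_centIndex_le {n : ℕ} {a b : G} (ha : centIndex a ≤ n ^ 2)
    (hb : centIndex b ≤ n ^ 2) (hab : ¬ centIndex (a * b) ≤ n ^ 2) :
    2 * Nat.card {x : G // centIndex x ≤ n} ≤ Nat.card {x : G // centIndex x ≤ n ^ 5} := by
  rw [two_mul, ← Nat.card_sum]
  have h4 : centIndex (a * b) ≤ n ^ 4 :=
    (centIndex_mul_le a b).trans ((Nat.mul_le_mul ha hb).trans (by rw [← pow_add]))
  refine Nat.card_le_card_of_injective (Sum.elim
    (fun x => ⟨x.1, x.2.trans (Nat.le_self_pow (by norm_num) n)⟩)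
    (fun x => ⟨a * b * x.1, (centIndex_mul_le _ _).trans
      ((Nat.mul_le_mul h4 x.2).trans (by rw [← pow_succ]))⟩)) ?_
  -- The set of elements of class size at most `n` and its translate by `a * b` are disjoint:
  -- otherwise `a * b` is a quotient of two such elements and has class size at most `n ^ 2`.
  have key : ∀ x y : G, centIndex x ≤ n → centIndex y ≤ n → x ≠ a * b * y := by
    rintro x y hx hy rfl
    apply hab
    have : a * b = (a * b * y) * y⁻¹ := by group
    rw [this]
    refine (centIndex_mul_le _ _).trans ?_
    rw [centIndex_inv, pow_two]
    exact Nat.mul_le_mul hx hy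
  rintro (⟨x, hx⟩ | ⟨x, hx⟩) (⟨y, hy⟩ | ⟨y, hy⟩) h
  · simpa using h
  · exact absurd (congrArg Subtype.val h) (key x y hx hy)
  · exact absurd (congrArg Subtype.val h).symm (key y x hy hx)
  · simpa using h

end CentralizerIndex

/-! ### Neumann's structure theorem -/

/-- A finite group whose commuting probability is at least `ε` has a subgroup of bounded index
all of whose elements have bounded conjugacy classes. -/
theorem exists_subgroup_centIndex_le {ε : ℝ} (hε : 0 < ε) :
    ∃ m N : ℕ, ∀ (G : Type u) [Group G] [Finite G], ε ≤ (commProb G : ℝ) →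
      ∃ F : Subgroup G, F.index ≤ m ∧ ∀ x ∈ F, centIndex x ≤ N := by
  obtain ⟨n, hn⟩ := exists_nat_ge (2 / ε)
  have hn2 : 2 ≤ ε * n := by rwa [div_le_iff₀' hε] at hn
  have hn1 : 1 ≤ n := by
    rcases Nat.eq_zero_or_pos n with h | h
    · subst h; norm_num at hn2
    · exact h
  -- A set of density at least ε/2 cannot double `K` times, so closure under products must occur at
  -- some stage before `K`.
  obtain ⟨K, hK⟩ := pow_unbounded_of_one_lt (2 / ε) (one_lt_two (α := ℝ))
  refine ⟨n, (n ^ 5 ^ K) ^ 2, fun G _ _ hG => ?_⟩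
  have hpos : (0 : ℝ) < Nat.card G := Nat.cast_pos.2 Nat.card_pos
  have h0 := card_centIndex_le_ge hG hn2
  obtain ⟨k, hk, hcl⟩ : ∃ k < K, ∀ a b : G, centIndex a ≤ (n ^ 5 ^ k) ^ 2 →
      centIndex b ≤ (n ^ 5 ^ k) ^ 2 → centIndex (a * b) ≤ (n ^ 5 ^ k) ^ 2 := by
    by_contra! hcon
    have grow : ∀ k ≤ K, 2 ^ k * Nat.card {x : G // centIndex x ≤ n} ≤
        Nat.card {x : G // centIndex x ≤ n ^ 5 ^ k} := by
      intro k
      induction k with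
      | zero => intro _; simp
      | succ k ih =>
        intro hk
        obtain ⟨a, b, ha, hb, hab⟩ := hcon k hk
        have := two_mul_card_centIndex_le ha hb (not_le.2 hab)
        rw [← pow_mul, ← pow_succ] at this
        have ih := ih (by omega)
        rw [pow_succ]
        linarith
    have h1 := (grow K le_rfl).trans (Finite.card_subtype_le _)
    have h2 : (2 : ℝ) ^ K * Nat.card {x : G // centIndex x ≤ n} ≤ Nat.card G := by
      exact_mod_cast h1
    have h3 : (2 : ℝ) ^ K * (ε / 2 * Nat.card G) ≤ Nat.card G :=
      (by gcongr : (2 : ℝ) ^ K * (ε / 2 * Nat.card G) ≤ _).trans h2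
    rw [div_lt_iff₀ hε] at hK
    nlinarith
  have hnk : n ≤ (n ^ 5 ^ k) ^ 2 := by
    rw [← pow_mul]
    exact Nat.le_self_pow (by positivity) n
  obtain ⟨F, hF⟩ : ∃ F : Subgroup G, ∀ x, x ∈ F ↔ centIndex x ≤ (n ^ 5 ^ k) ^ 2 := by
    refine ⟨{ carrier := {x | centIndex x ≤ (n ^ 5 ^ k) ^ 2}
              mul_mem' := fun {a b} ha hb => hcl a b ha hb
              one_mem' := ?_
              inv_mem' := fun {x} hx => (centIndex_inv x).trans_le hx }, fun x => Iff.rfl⟩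
    have : centIndex (1 : G) = 1 := by
      rw [centIndex, Subgroup.index_eq_one, eq_top_iff]
      exact fun x _ => mem_centralizer_singleton.2 (Commute.one_left x)
    exact this.trans_le (Nat.one_le_pow _ _ (Nat.one_le_pow _ _ hn1))
  refine ⟨F, ?_, fun x hx => le_trans ((hF x).1 hx) ?_⟩
  · have hF : Nat.card {x : G // centIndex x ≤ n} ≤ Nat.card F :=
      Nat.card_le_card_of_injective (fun x => (⟨x.1, (hF x.1).2 (x.2.trans hnk)⟩ : F))
        (fun x y h => Subtype.ext (congrArg (fun z : F => (z : G)) h))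
    have h1 : (Nat.card F : ℝ) * F.index = Nat.card G := by exact_mod_cast F.card_mul_index
    have h2 : ε / 2 * Nat.card G ≤ Nat.card F := h0.trans (by exact_mod_cast hF)
    have h3 : ε / 2 * F.index ≤ 1 := by
      refine le_of_mul_le_mul_right ?_ hpos
      calc ε / 2 * F.index * Nat.card G = (ε / 2 * Nat.card G) * F.index := by ring
        _ ≤ Nat.card F * F.index := by gcongr
        _ = 1 * Nat.card G := by rw [h1, one_mul]
    have h4 : (F.index : ℝ) ≤ n := by nlinarith
    exact_mod_cast h4
  · exact Nat.pow_le_pow_left (Nat.pow_le_pow_right hn1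
      (Nat.pow_le_pow_right (by norm_num) hk.le)) 2

/-- A group whose conjugacy classes have bounded size has a subgroup of bounded index
with a bounded number of commutators. -/
theorem exists_subgroup_card_commutatorSet_le {G : Type u} [Group G] [Finite G] {N : ℕ}
    (hN : ∀ x : G, centIndex x ≤ N) :
    ∃ C : Subgroup G, C.index ≤ N ^ N ∧ Nat.card (commutatorSet C) ≤ N ^ 2 := by
  classical
  obtain ⟨x, hx⟩ := Finite.exists_max (centIndex : G → ℕ)
  let Q := G ⧸ Subgroup.centralizer ({x} : Set G)
  have := Fintype.ofFinite Q
  have hQ : Nat.card Q ≤ N := hN x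
  have hN1 : 1 ≤ N := (centIndex_pos x).trans_le (hN x)
  let C : Subgroup G := ⨅ q : Q, Subgroup.centralizer ({q.out} : Set G)
  have hC : ∀ c ∈ C, ∀ q : Q, Commute q.out c := fun c hc q =>
    mem_centralizer_singleton.1 (Subgroup.mem_iInf.1 hc q)
  let f : Q → G := fun q => q.out * x * q.out⁻¹
  have hf : ∀ g : G, g * x * g⁻¹ = f (QuotientGroup.mk g) := by
    intro g
    obtain ⟨h, hh⟩ := QuotientGroup.mk_out_eq_mul (Subgroup.centralizer ({x} : Set G)) g
    have hcomm := mem_centralizer_singleton.1 h.2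
    change _ = Quotient.out _ * x * (Quotient.out _)⁻¹
    calc g * x * g⁻¹ = g * (x * h) * ((h : G)⁻¹ * g⁻¹) := by group
      _ = _ := by rw [hcomm.eq, hh, mul_inv_rev]; group
  have hf_inj : Function.Injective f := by
    intro q r h
    rw [← q.out_eq', ← r.out_eq']
    refine QuotientGroup.eq.2 (mem_centralizer_singleton.2 ?_)
    have h' : q.out * x * q.out⁻¹ = r.out * x * r.out⁻¹ := h
    change x * (q.out⁻¹ * r.out) = q.out⁻¹ * r.out * x
    calc x * (q.out⁻¹ * r.out) = q.out⁻¹ * (q.out * x * q.out⁻¹) * r.out := by group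
      _ = _ := by rw [h']; group
  -- Conjugating `x * c` by the representatives gives as many distinct elements as the class of `x`
  -- has. By maximality of that class these are all the conjugates of `x * c`.
  have key : ∀ c ∈ C, ∀ g : G, ∃ q : Q, g * (x * c) * g⁻¹ = f q * c := by
    intro c hc g
    have hfc : ∀ q : Q, q.out * (x * c) * q.out⁻¹ = f q * c := by
      intro q
      change _ = q.out * x * q.out⁻¹ * c
      rw [mul_assoc _ q.out⁻¹ c, ((hC c hc q).inv_left).eq]
      group
    let φ : Q → G ⧸ Subgroup.centralizer ({x * c} : Set G) := fun q => QuotientGroup.mk q.out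
    have hφ : Function.Injective φ := by
      intro q r h
      have h1 := mem_centralizer_singleton.1 (QuotientGroup.eq.1 h)
      apply hf_inj
      apply mul_right_cancel (b := c)
      rw [← hfc, ← hfc]
      calc q.out * (x * c) * q.out⁻¹ = q.out * ((x * c) * (q.out⁻¹ * r.out)) * r.out⁻¹ := by group
        _ = _ := by rw [h1.eq]; group
    have hφ' : Function.Bijective φ :=
      hφ.bijective_of_nat_card_le (hx (x * c))
    obtain ⟨q, hq⟩ := hφ'.2 (QuotientGroup.mk g)
    refine ⟨q, ?_⟩
    have h1 := mem_centralizer_singleton.1 (QuotientGroup.eq.1 hq)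
    rw [← hfc]
    symm
    calc q.out * (x * c) * q.out⁻¹ = q.out * ((x * c) * (q.out⁻¹ * g)) * g⁻¹ := by group
      _ = _ := by rw [h1.eq]; group
  refine ⟨C, ?_, ?_⟩
  · calc C.index ≤ ∏ q : Q, (Subgroup.centralizer ({q.out} : Set G)).index :=
          Subgroup.index_iInf_le _
      _ ≤ ∏ _q : Q, N := Finset.prod_le_prod' fun q _ => hN q.out
      _ = N ^ Nat.card Q := by rw [Finset.prod_const, Finset.card_univ, Nat.card_eq_fintype_card]
      _ ≤ N ^ N := Nat.pow_le_pow_right hN1 hQ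
  -- Since `⁅g, c⁆` is the inverse of `g * x * g⁻¹` times `g * (x * c) * g⁻¹ * c⁻¹`, it is
  -- determined by two conjugates of `x`.
  · have hsub : ∀ z : commutatorSet C, ∃ p : Q × Q, ((z : C) : G) = (f p.1)⁻¹ * f p.2 := by
      rintro ⟨_, g, c, rfl⟩
      obtain ⟨q, hq⟩ := key c c.2 g
      refine ⟨(QuotientGroup.mk (g : G), q), ?_⟩
      rw [← hf]
      have : f q = g * (x * c) * (g : G)⁻¹ * (c : G)⁻¹ := by rw [hq]; group
      rw [this]
      simp only [commutatorElement_def, Subgroup.coe_mul, Subgroup.coe_inv]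
      group
    choose p hp using hsub
    have hinj : Function.Injective p := by
      intro y z h
      apply Subtype.ext
      apply Subtype.ext
      rw [hp, hp, h]
    calc Nat.card (commutatorSet C) ≤ Nat.card (Q × Q) := Nat.card_le_card_of_injective p hinj
      _ = Nat.card Q * Nat.card Q := Nat.card_prod _ _
      _ ≤ N ^ 2 := by rw [pow_two]; exact Nat.mul_le_mul hQ hQ

theorem Subgroup.relIndex_le_index {G : Type u} [Group G] [Finite G] (H K : Subgroup G) :
    H.relIndex K ≤ H.index := by
  rw [← relIndex_top_right]
  exact relIndex_le_of_le_right le_top (by rw [relIndex_top_right]; exact FiniteIndex.index_ne_zero)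

theorem Subgroup.index_normalCore_le {G : Type u} [Group G] [Finite G] (H : Subgroup G) :
    H.normalCore.index ≤ H.index.factorial := by
  rw [normalCore_eq_ker, index_ker, index_eq_card, ← Nat.card_perm]
  exact Nat.card_le_card_of_injective _ Subtype.val_injective

/-- Neumann's theorem: a finite group whose commuting probability is bounded away from zero has a
normal subgroup of bounded index and of class at most two whose commutator subgroup has bounded
order. -/
theorem exists_normal_of_le_commProb {ε : ℝ} (hε : 0 < ε) :
    ∃ m c : ℕ, ∀ (G : Type u) [Group G] [Finite G], ε ≤ (commProb G : ℝ) →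
      ∃ A : Subgroup G, A.Normal ∧ A.index ≤ m ∧ Nat.card (⁅A, A⁆ : Subgroup G) ≤ c ∧
        A ≤ Subgroup.centralizer (⁅A, A⁆ : Subgroup G) := by
  classical
  obtain ⟨m, N, h⟩ := exists_subgroup_centIndex_le.{u} hε
  -- Summing over all `j ≤ N ^ 2` dominates the Schur-type bound for whichever number of commutators
  -- occurs, without appealing to monotonicity.
  let c := ∑ j ∈ Finset.range (N ^ 2 + 1), Subgroup.cardCommutatorBound j
  refine ⟨((N ^ N * m) * N ^ c).factorial, c, fun G _ _ hG => ?_⟩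
  obtain ⟨F, hFm, hFN⟩ := h G hG
  have hFN' : ∀ x : F, centIndex x ≤ N := by
    refine fun x => le_trans ?_ (hFN x x.2)
    have : Subgroup.centralizer ({x} : Set F) =
        (Subgroup.centralizer ({(x : G)} : Set G)).subgroupOf F := by
      ext y
      rw [Subgroup.mem_subgroupOf, mem_centralizer_singleton, mem_centralizer_singleton]
      simp [Commute, SemiconjBy, Subtype.ext_iff]
    rw [centIndex, this]
    exact Subgroup.relIndex_le_index _ _
  have hN1 : 1 ≤ N := (centIndex_pos _).trans_le (hFN 1 F.one_mem)
  obtain ⟨C, hCi, hCc⟩ := exists_subgroup_card_commutatorSet_le hFN'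
  let D : Subgroup G := C.map F.subtype
  have hDi : D.index ≤ N ^ N * m := by
    rw [Subgroup.index_map_subtype]
    exact Nat.mul_le_mul hCi hFm
  have hDF : D ≤ F := Subgroup.map_subtype_le C
  have hDc : Nat.card (⁅D, D⁆ : Subgroup G) ≤ c := by
    have h1 : ⁅D, D⁆ = ((commutator C).map C.subtype).map F.subtype := by
      rw [commutator_def, Subgroup.map_commutator, ← MonoidHom.range_eq_map,
        Subgroup.range_subtype, Subgroup.map_commutator]
    rw [h1, Subgroup.card_map_of_injective F.subtype_injective,
      Subgroup.card_map_of_injective C.subtype_injective]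
    refine (Subgroup.card_commutator_le_of_finite_commutatorSet C).trans ?_
    exact Finset.single_le_sum (f := Subgroup.cardCommutatorBound) (fun _ _ => Nat.zero_le _)
      (Finset.mem_range.2 (Nat.lt_succ_of_le hCc))
  have := Fintype.ofFinite (⁅D, D⁆ : Subgroup G)
  -- Centralizing the boundedly many elements of `⁅D, D⁆`, each of class size at most `N`, costs
  -- bounded index and forces class at most two.
  let E : Subgroup G := D ⊓ ⨅ z : (⁅D, D⁆ : Subgroup G), Subgroup.centralizer ({(z : G)} : Set G)
  have hE : E.index ≤ (N ^ N * m) * N ^ c := by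
    refine Subgroup.index_inf_le.trans (Nat.mul_le_mul hDi ((Subgroup.index_iInf_le _).trans ?_))
    calc _ ≤ ∏ _z : (⁅D, D⁆ : Subgroup G), N := Finset.prod_le_prod' fun z _ =>
          hFN z (hDF (Subgroup.commutator_le_self D z.2))
      _ = N ^ Nat.card (⁅D, D⁆ : Subgroup G) := by
          rw [Finset.prod_const, Finset.card_univ, Nat.card_eq_fintype_card]
      _ ≤ N ^ c := Nat.pow_le_pow_right hN1 hDc
  have hED : E.normalCore ≤ D := E.normalCore_le.trans inf_le_left
  have hcomm : ⁅E.normalCore, E.normalCore⁆ ≤ ⁅D, D⁆ := Subgroup.commutator_mono hED hED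
  refine ⟨E.normalCore, inferInstance, E.index_normalCore_le.trans (Nat.factorial_le hE),
    (Subgroup.card_le_of_le hcomm).trans hDc, fun a ha => ?_⟩
  rw [Subgroup.mem_centralizer_iff]
  intro z hz
  have h1 := (Subgroup.mem_inf.1 (E.normalCore_le ha)).2
  exact (mem_centralizer_singleton.1 (Subgroup.mem_iInf.1 h1 ⟨z, hcomm hz⟩)).eq

/-! ### Class sizes in a group and in its quotients -/

theorem commProb_eq_sum {G : Type u} [Group G] [Fintype G] :
    (commProb G : ℝ) = (∑ x : G, (1 : ℝ) / centIndex x) / Nat.card G := by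
  have hpos : (0 : ℝ) < Nat.card G := Nat.cast_pos.2 Nat.card_pos
  rw [commProb_def, card_commute_eq_sum]
  push_cast
  rw [pow_two, ← div_div, Finset.sum_div]
  congr 1
  refine Finset.sum_congr rfl fun x _ => ?_
  have h := card_centralizer_mul_centIndex x
  have hx : (0 : ℝ) < centIndex x := by exact_mod_cast centIndex_pos x
  rw [div_eq_div_iff hpos.ne' hx.ne', one_mul]
  exact_mod_cast h

theorem sum_quotient_mk {G : Type u} [Group G] [Fintype G] (L : Subgroup G) [Fintype (G ⧸ L)]
    (f : G ⧸ L → ℝ) : ∑ x : G, f x = Nat.card L * ∑ q, f q := by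
  classical
  have := Fintype.ofFinite L
  rw [Fintype.sum_equiv (Subgroup.groupEquivQuotientProdSubgroup (s := L)) (fun x : G => f x)
    (fun p => f p.1), Fintype.sum_prod_type]
  · simp [Finset.mul_sum]
  · intro x
    rfl

theorem commProb_quotient_eq_sum {G : Type u} [Group G] [Fintype G] (L : Subgroup G) [L.Normal] :
    (commProb (G ⧸ L) : ℝ) = (∑ x : G, (1 : ℝ) / centIndex (x : G ⧸ L)) / Nat.card G := by
  classical
  have := Fintype.ofFinite (G ⧸ L)
  have hpos : (0 : ℝ) < Nat.card (G ⧸ L) := Nat.cast_pos.2 Nat.card_pos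
  have hpos' : (0 : ℝ) < Nat.card L := Nat.cast_pos.2 Nat.card_pos
  rw [commProb_eq_sum, sum_quotient_mk L (fun q => (1 : ℝ) / centIndex q),
    Subgroup.card_eq_card_quotient_mul_card_subgroup L]
  push_cast
  field_simp

theorem mem_comap_centralizer_mk {G : Type u} [Group G] {L : Subgroup G} [L.Normal] {u v : G} :
    v ∈ (Subgroup.centralizer ({(u : G ⧸ L)} : Set (G ⧸ L))).comap (QuotientGroup.mk' L) ↔
      ⁅u, v⁆ ∈ L := by
  rw [Subgroup.mem_comap, mem_centralizer_singleton, ← commutatorElement_eq_one_iff_commute,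
    ← QuotientGroup.eq_one_iff]
  rfl

theorem index_comap_centralizer_mk {G : Type u} [Group G] {L : Subgroup G} [L.Normal] (u : G) :
    ((Subgroup.centralizer ({(u : G ⧸ L)} : Set (G ⧸ L))).comap (QuotientGroup.mk' L)).index =
      centIndex (u : G ⧸ L) :=
  Subgroup.index_comap_of_surjective _ (QuotientGroup.mk'_surjective L)

theorem centIndex_mk_le {G : Type u} [Group G] [Finite G] {L : Subgroup G} [L.Normal] (u : G) :
    centIndex (u : G ⧸ L) ≤ centIndex u := by
  rw [← index_comap_centralizer_mk]
  refine Subgroup.index_le_of_le fun v hv => mem_comap_centralizer_mk.2 ?_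
  rw [commutatorElement_eq_one_iff_commute.2 (mem_centralizer_singleton.1 hv)]
  exact L.one_mem

/-- The values of `⁅u, ·⁆` correspond to the left cosets of the centralizer of `u`, so counting
commutators bounds class sizes from below. -/
theorem commutatorElement_eq_iff {G : Type u} [Group G] {u v w : G} :
    ⁅u, v⁆ = ⁅u, w⁆ ↔ Commute u (v⁻¹ * w) := by
  rw [← commutatorElement_eq_one_iff_commute]
  simp only [commutatorElement_def]
  constructor
  · intro h
    have h' : v * u⁻¹ * v⁻¹ = w * u⁻¹ * w⁻¹ := by
      apply mul_left_cancel (a := u)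
      simpa only [mul_assoc] using h
    calc u * (v⁻¹ * w) * u⁻¹ * (v⁻¹ * w)⁻¹ = u * v⁻¹ * (w * u⁻¹ * w⁻¹) * v := by group
      _ = 1 := by rw [← h']; group
  · intro h
    have h' : w * u⁻¹ * w⁻¹ = v * u⁻¹ * v⁻¹ := by
      calc w * u⁻¹ * w⁻¹ = v * u⁻¹ * (u * (v⁻¹ * w) * u⁻¹ * (v⁻¹ * w)⁻¹) * v⁻¹ := by group
        _ = _ := by rw [h]; group
    calc u * v * u⁻¹ * v⁻¹ = u * (v * u⁻¹ * v⁻¹) := by group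
      _ = _ := by rw [← h']; group

/-- If every element of the normal subgroup `L` is a commutator `⁅u, v⁆`, then the conjugacy class
of `u` is the full preimage of a conjugacy class of `G ⧸ L`. -/
theorem card_mul_centIndex_mk_le {G : Type u} [Group G] [Finite G] {L : Subgroup G} [L.Normal]
    {u : G} (h : ∀ l ∈ L, ∃ v, ⁅u, v⁆ = l) :
    Nat.card L * centIndex (u : G ⧸ L) ≤ centIndex u := by
  set D := (Subgroup.centralizer ({(u : G ⧸ L)} : Set (G ⧸ L))).comap (QuotientGroup.mk' L) with hD
  have hle : Subgroup.centralizer ({u} : Set G) ≤ D := by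
    refine fun v hv => mem_comap_centralizer_mk.2 ?_
    rw [commutatorElement_eq_one_iff_commute.2 (mem_centralizer_singleton.1 hv)]
    exact L.one_mem
  rw [← index_comap_centralizer_mk, centIndex, ← Subgroup.relIndex_mul_index hle]
  refine Nat.mul_le_mul_right _ ?_
  choose! c hc using h
  have hcD : ∀ l ∈ L, c l ∈ D := fun l hl => mem_comap_centralizer_mk.2 ((hc l hl).symm ▸ hl)
  refine Nat.card_le_card_of_injective
    (fun l : L => (QuotientGroup.mk (⟨c l, hcD l l.2⟩ : D) :
      D ⧸ (Subgroup.centralizer ({u} : Set G)).subgroupOf D)) ?_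
  intro l l' hll
  have h1 := QuotientGroup.eq.1 hll
  rw [Subgroup.mem_subgroupOf, mem_centralizer_singleton] at h1
  apply Subtype.ext
  rw [← hc l l.2, ← hc l' l'.2]
  exact commutatorElement_eq_iff.2 h1

/-! ### Passing to the quotient or shrinking the commutator subgroup -/

section Dichotomy

variable {G : Type u} [Group G] {A : Subgroup G}

/-- Conjugation by `x ∈ A` is trivial on `⁅A, A⁆`. Only `⁅y, c⁆` has to lie there, so `y` may be
outside `A`. -/
theorem commutatorElement_mul_left_eq {x y c : G} (hA : A ≤ Subgroup.centralizer (⁅A, A⁆ : Subgroup G))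
    (hx : x ∈ A) (hyc : ⁅y, c⁆ ∈ ⁅A, A⁆) : ⁅x * y, c⁆ = ⁅y, c⁆ * ⁅x, c⁆ := by
  have h := Subgroup.mem_centralizer_iff.1 (hA hx) _ hyc
  calc ⁅x * y, c⁆ = x * ⁅y, c⁆ * x⁻¹ * ⁅x, c⁆ := by simp only [commutatorElement_def]; group
    _ = _ := by rw [← h]; group

theorem commutatorElement_mul_right_eq {u c d : G}
    (hA : A ≤ Subgroup.centralizer (⁅A, A⁆ : Subgroup G))
    (hc : c ∈ A) (hud : ⁅u, d⁆ ∈ ⁅A, A⁆) : ⁅u, c * d⁆ = ⁅u, c⁆ * ⁅u, d⁆ := by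
  have h := Subgroup.mem_centralizer_iff.1 (hA hc) _ hud
  calc ⁅u, c * d⁆ = ⁅u, c⁆ * (c * ⁅u, d⁆) * c⁻¹ := by simp only [commutatorElement_def]; group
    _ = _ := by rw [← h]; group

/-- The subgroup of commutators `⁅u, c⁆` lying in `⁅A, A⁆`, for `c ∈ A`. -/
theorem exists_subgroup_commutators [Finite G]
    (hA : A ≤ Subgroup.centralizer (⁅A, A⁆ : Subgroup G)) (u : G) :
    ∃ M : Subgroup G, M ≤ ⁅A, A⁆ ∧ (∀ z ∈ M, ∃ c, ⁅u, c⁆ = z) ∧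
      ∀ c ∈ A, ⁅u, c⁆ ∈ ⁅A, A⁆ → ⁅u, c⁆ ∈ M := by
  let S : Submonoid G :=
    { carrier := {z | ∃ c ∈ A, ⁅u, c⁆ = z ∧ z ∈ ⁅A, A⁆}
      one_mem' := ⟨1, A.one_mem, commutatorElement_one_right u, Subgroup.one_mem _⟩
      mul_mem' := by
        rintro _ _ ⟨c, hc, rfl, hc'⟩ ⟨d, hd, rfl, hd'⟩
        exact ⟨c * d, A.mul_mem hc hd, commutatorElement_mul_right_eq hA hc hd',
          Subgroup.mul_mem _ hc' hd'⟩ }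
  refine ⟨{ S with inv_mem' := fun {z} hz => ?_ }, ?_, ?_, ?_⟩
  · have : z⁻¹ = z ^ (orderOf z - 1) := by
      rw [eq_comm, eq_inv_iff_mul_eq_one, ← pow_succ, Nat.sub_add_cancel (orderOf_pos z),
        pow_orderOf_eq_one]
    rw [this]
    exact S.pow_mem hz _
  · rintro z ⟨c, hc, -, hz⟩
    exact hz
  · rintro z ⟨c, hc, hz, -⟩
    exact ⟨c, hz⟩
  · exact fun c hc hcz => ⟨c, hc, rfl, hcz⟩

/-- Let `A` be a normal subgroup of class at most two. Either most commuting pairs are accounted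
for by the quotient by `⁅A, A⁆`, or `A` contains a subgroup of bounded index with smaller commutator
subgroup. -/
theorem commProb_le_or_exists_normal_lt [Finite G] [A.Normal]
    (hA : A ≤ Subgroup.centralizer (⁅A, A⁆ : Subgroup G)) {m c r : ℕ} (hr : 1 ≤ r)
    (hm : A.index ≤ m) (hc : Nat.card (⁅A, A⁆ : Subgroup G) ≤ c) :
    (commProb G : ℝ) ≤
        commProb (G ⧸ ⁅A, A⁆) / Nat.card (⁅A, A⁆ : Subgroup G) + 2 / r ∨
      ∃ B : Subgroup G, B.Normal ∧ B ≤ A ∧ B.index ≤ (2 ^ c * m * r * r).factorial ∧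
        ⁅B, B⁆ < ⁅A, A⁆ := by
  classical
  have := Fintype.ofFinite G
  set L : Subgroup G := ⁅A, A⁆ with hL
  choose M hML hM hMmem using exists_subgroup_commutators hA
  have hr0 : (0 : ℝ) < r := by exact_mod_cast hr
  have hG0 : (0 : ℝ) < Nat.card G := Nat.cast_pos.2 Nat.card_pos
  have hL0 : (0 : ℝ) < Nat.card L := Nat.cast_pos.2 Nat.card_pos
  -- For `u` outside `bad`, either the class of `u` exceeds `r`, or it is the full preimage of its
  -- image modulo `L`. If `bad` has density at most 1/r, this gives the first alternative, one 1/r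
  -- coming from each source of error.
  let bad : Finset G := Finset.univ.filter fun u => centIndex (u : G ⧸ L) ≤ r ∧ M u ≠ L
  by_cases hbad : bad.card * r ≤ Nat.card G
  · left
    have hu : ∀ u : G, (1 : ℝ) / centIndex u ≤
        1 / centIndex (u : G ⧸ L) / Nat.card L + 1 / r + if u ∈ bad then 1 else 0 := by
      intro u
      have h1 : (0 : ℝ) < centIndex u := by exact_mod_cast centIndex_pos u
      have h2 : (0 : ℝ) < centIndex (u : G ⧸ L) := by exact_mod_cast centIndex_pos (u : G ⧸ L)
      have h3 : (0 : ℝ) ≤ 1 / centIndex (u : G ⧸ L) / Nat.card L := by positivity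
      have h4 : (0 : ℝ) ≤ 1 / r := by positivity
      by_cases hub : u ∈ bad
      · rw [if_pos hub]
        have : (1 : ℝ) / centIndex u ≤ 1 := by
          rw [div_le_one h1]
          exact_mod_cast centIndex_pos u
        linarith
      · rw [if_neg hub, add_zero]
        by_cases hur : centIndex (u : G ⧸ L) ≤ r
        · have hMu : M u = L := by
            by_contra h
            exact hub (Finset.mem_filter.2 ⟨Finset.mem_univ _, hur, h⟩)
          have h5 := card_mul_centIndex_mk_le (L := L) (u := u) fun l hl => hM u l (hMu.symm ▸ hl)
          have h6 : (1 : ℝ) / centIndex u ≤ 1 / centIndex (u : G ⧸ L) / Nat.card L := by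
            rw [div_div]
            refine one_div_le_one_div_of_le (by positivity) ?_
            rw [mul_comm]
            exact_mod_cast h5
          linarith
        · have h5 : (1 : ℝ) / centIndex u ≤ 1 / r := by
            refine one_div_le_one_div_of_le hr0 ?_
            exact_mod_cast (not_le.1 hur).le.trans (centIndex_mk_le u)
          linarith
    have hsum := Finset.sum_le_sum fun u (_ : u ∈ Finset.univ) => hu u
    rw [Finset.sum_add_distrib, Finset.sum_add_distrib, Finset.sum_const, nsmul_eq_mul,
      Finset.card_univ, ← Nat.card_eq_fintype_card, ← Finset.sum_div, Finset.sum_ite_mem,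
      Finset.univ_inter, Finset.sum_const, nsmul_eq_mul, mul_one] at hsum
    have hb : (bad.card : ℝ) ≤ Nat.card G * (1 / r) := by
      rw [mul_one_div, le_div_iff₀ hr0]
      exact_mod_cast hbad
    rw [commProb_eq_sum, commProb_quotient_eq_sum, div_le_iff₀ hG0]
    refine hsum.trans ((add_le_add le_rfl hb).trans (le_of_eq ?_))
    field_simp
    ring
  · right
    rw [not_le] at hbad
    -- Pigeonhole: many bad elements share both their coset of `A` and their subgroup `M u`.
    let g : G → (G ⧸ A) × Set L := fun u => (QuotientGroup.mk u, {l : L | (l : G) ∈ M u})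
    have := Fintype.ofFinite (G ⧸ A)
    have := Fintype.ofFinite L
    obtain ⟨y, hy⟩ := Finite.exists_max (fun y => (bad.filter fun u => g u = y).card)
    have hcard := Finset.card_le_mul_card_image_of_maps_to (s := bad) (t := Finset.univ) (f := g)
      (fun _ _ => Finset.mem_univ _) _ (fun z _ => hy z)
    have hT : (Finset.univ : Finset ((G ⧸ A) × Set L)).card ≤ 2 ^ c * m := by
      rw [Finset.card_univ, Fintype.card_prod, Fintype.card_set, ← Nat.card_eq_fintype_card,
        ← Nat.card_eq_fintype_card, mul_comm]
      exact Nat.mul_le_mul (Nat.pow_le_pow_right (by norm_num) hc) hm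
    set S := bad.filter fun u => g u = y with hS
    have hSG : Nat.card G < S.card * (2 ^ c * m * r) := by
      calc Nat.card G < bad.card * r := hbad
        _ ≤ S.card * (2 ^ c * m) * r :=
          Nat.mul_le_mul_right _ (hcard.trans (Nat.mul_le_mul_left _ hT))
        _ = _ := by ring
    obtain ⟨u, huS⟩ : S.Nonempty := by
      rw [← Finset.card_pos]
      by_contra h
      rw [Nat.eq_zero_of_not_pos h, zero_mul] at hSG
      exact absurd hSG (Nat.not_lt_zero _)
    obtain ⟨hub, huy⟩ := Finset.mem_filter.1 huS
    obtain ⟨-, hur, huM⟩ := Finset.mem_filter.1 hub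
    -- `T` is designed to contain all quotients `v * u⁻¹` with `v ∈ S`, which makes its index
    -- bounded.
    let T : Subgroup G :=
      { carrier := {x | x ∈ A ∧ ∀ c ∈ A, ⁅u, c⁆ ∈ L → ⁅x, c⁆ ∈ M u}
        one_mem' := ⟨A.one_mem, fun c _ _ => by
          rw [commutatorElement_one_left]; exact (M u).one_mem⟩
        mul_mem' := by
          rintro x y ⟨hx, hx'⟩ ⟨hy, hy'⟩
          refine ⟨A.mul_mem hx hy, fun c hc hcu => ?_⟩
          rw [commutatorElement_mul_left_eq hA hx (Subgroup.commutator_mem_commutator hy hc)]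
          exact (M u).mul_mem (hy' c hc hcu) (hx' c hc hcu)
        inv_mem' := by
          rintro x ⟨hx, hx'⟩
          refine ⟨A.inv_mem hx, fun c hc hcu => ?_⟩
          have h := commutatorElement_mul_left_eq (y := x) (x := x⁻¹) hA (A.inv_mem hx)
            (Subgroup.commutator_mem_commutator hx hc)
          rw [inv_mul_cancel, commutatorElement_one_left] at h
          rw [eq_inv_of_mul_eq_one_right h.symm]
          exact (M u).inv_mem (hx' c hc hcu) }
    have hTA : T ≤ A := fun x hx => hx.1
    have hST : ∀ v ∈ S, v * u⁻¹ ∈ T := by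
      intro v hv
      obtain ⟨hvb, hvy⟩ := Finset.mem_filter.1 hv
      have hg : g v = g u := hvy.trans huy.symm
      have h1 : v * u⁻¹ ∈ A := by
        have := QuotientGroup.eq.1 (congrArg Prod.fst hg).symm
        exact Subgroup.Normal.mem_comm ‹A.Normal› this
      have h2 : ∀ l ∈ L, l ∈ M v → l ∈ M u := by
        intro l hl hlv
        have : (⟨l, hl⟩ : L) ∈ {l : L | (l : G) ∈ M v} := hlv
        rw [show {l : L | (l : G) ∈ M v} = {l : L | (l : G) ∈ M u} from congrArg Prod.snd hg] at this
        exact this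
      refine ⟨h1, fun c hc hcu => ?_⟩
      have h3 : ⁅v, c⁆ = ⁅u, c⁆ * ⁅v * u⁻¹, c⁆ := by
        rw [← commutatorElement_mul_left_eq hA h1 hcu, inv_mul_cancel_right]
      have h4 : ⁅v, c⁆ ∈ L := by
        rw [h3]
        exact L.mul_mem hcu (Subgroup.commutator_mem_commutator h1 hc)
      have h5 : ⁅v * u⁻¹, c⁆ = ⁅u, c⁆⁻¹ * ⁅v, c⁆ := by rw [h3, inv_mul_cancel_left]
      rw [h5]
      exact (M u).mul_mem ((M u).inv_mem (hMmem u c hc hcu)) (h2 _ h4 (hMmem v c hc h4))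
    have hTi : T.index ≤ 2 ^ c * m * r := by
      have h1 : S.card ≤ Nat.card T := by
        rw [← Nat.card_eq_finsetCard]
        refine Nat.card_le_card_of_injective (fun v : S => (⟨v * u⁻¹, hST v v.2⟩ : T)) ?_
        intro v w h
        exact Subtype.ext (mul_right_cancel (congrArg Subtype.val h))
      have h2 : Nat.card T * T.index ≤ Nat.card T * (2 ^ c * m * r) := by
        rw [T.card_mul_index]
        exact hSG.le.trans (Nat.mul_le_mul_right _ h1)
      exact Nat.le_of_mul_le_mul_left h2 Nat.card_pos
    -- Centralizing `u` modulo `L` supplies the condition `⁅u, c⁆ ∈ L` in the definition of `T`, so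
    -- commutators in `E` fall into `M u`, a proper subgroup of `L` because `u` is bad.
    let E : Subgroup G := T ⊓
      (Subgroup.centralizer ({(u : G ⧸ L)} : Set (G ⧸ L))).comap (QuotientGroup.mk' L)
    have hE : E.index ≤ 2 ^ c * m * r * r := by
      refine Subgroup.index_inf_le.trans (Nat.mul_le_mul hTi ?_)
      rw [index_comap_centralizer_mk]
      exact hur
    have hEM : ⁅E.normalCore, E.normalCore⁆ ≤ M u := by
      refine Subgroup.commutator_le.2 fun x hx y hy => ?_
      have hx' := Subgroup.mem_inf.1 (E.normalCore_le hx)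
      have hy' := Subgroup.mem_inf.1 (E.normalCore_le hy)
      exact hx'.1.2 y (hTA hy'.1) (mem_comap_centralizer_mk.1 hy'.2)
    exact ⟨E.normalCore, inferInstance, E.normalCore_le.trans (inf_le_left.trans hTA),
      E.index_normalCore_le.trans (Nat.factorial_le hE),
      hEM.trans_lt (lt_of_le_of_ne (hML u) huM)⟩

end Dichotomy

/-! ### Groups with an abelian subgroup of bounded index -/

theorem commProb_congr {G H : Type u} [Group G] [Group H] (e : G ≃* H) :
    commProb G = commProb H := by
  rw [commProb_def, commProb_def, Nat.card_congr e.toEquiv]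
  congr 2
  refine Nat.card_congr ((e.toEquiv.prodCongr e.toEquiv).subtypeEquiv fun p => ?_)
  exact (commute_map_iff e.injective).symm

/-- The commuting probability of a group whose center has index `n` is an integer over `n ^ 2`. -/
theorem exists_commProb_eq_div_index_center_sq (G : Type u) [Group G] [Finite G] :
    ∃ j ≤ (Subgroup.center G).index ^ 2,
      (commProb G : ℝ) = j / ((Subgroup.center G).index : ℝ) ^ 2 := by
  classical
  have := Fintype.ofFinite G
  set Z := Subgroup.center G with hZ
  have := Fintype.ofFinite (G ⧸ Z)
  have hn : Z.index ≠ 0 := Subgroup.FiniteIndex.index_ne_zero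
  have hn' : (0 : ℝ) < Z.index := by exact_mod_cast Nat.pos_of_ne_zero hn
  have hZ0 : (0 : ℝ) < Nat.card Z := Nat.cast_pos.2 Nat.card_pos
  have hdvd : ∀ x : G, centIndex x ∣ Z.index := fun x =>
    Subgroup.index_dvd_of_le (Subgroup.center_le_centralizer _)
  -- Class sizes divide the index of the center and are constant on its cosets, so the average of
  -- their reciprocals can be taken over the quotient by the center.
  have hout : ∀ x : G, centIndex x = centIndex (QuotientGroup.mk x : G ⧸ Z).out := by
    intro x
    obtain ⟨z, hz⟩ := QuotientGroup.mk_out_eq_mul Z x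
    rw [hz, centIndex, centIndex]
    congr 1
    ext y
    rw [mem_centralizer_singleton, mem_centralizer_singleton]
    have h1 : Commute (z : G) y := (Subgroup.mem_center_iff.1 z.2 y).symm
    refine ⟨fun h => h.mul_left h1, fun h => ?_⟩
    simpa using h.mul_left h1.inv_left
  have hcard : (Nat.card G : ℝ) = Z.index * Nat.card Z := by
    exact_mod_cast Z.index_mul_card.symm
  have hP : (commProb G : ℝ) = ((∑ q : G ⧸ Z, Z.index / centIndex q.out : ℕ) : ℝ) /
      (Z.index : ℝ) ^ 2 := by
    rw [commProb_eq_sum, Finset.sum_congr rfl fun x _ => by rw [hout x],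
      sum_quotient_mk Z (fun q => (1 : ℝ) / centIndex q.out), hcard]
    push_cast
    have : ∀ q : G ⧸ Z, ((Z.index / centIndex q.out : ℕ) : ℝ) =
        Z.index * (1 / centIndex q.out) := by
      intro q
      rw [Nat.cast_div (hdvd _) (by exact_mod_cast (centIndex_pos _).ne'), mul_one_div]
    rw [Finset.sum_congr rfl fun q _ => this q, ← Finset.mul_sum]
    field_simp
  refine ⟨_, ?_, hP⟩
  calc _ ≤ ∑ _q : G ⧸ Z, Z.index := Finset.sum_le_sum fun q _ => Nat.div_le_self _ _
    _ = Z.index ^ 2 := by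
      rw [Finset.sum_const, smul_eq_mul, Finset.card_univ, ← Nat.card_eq_fintype_card, pow_two]
      rfl

section AbelianSubgroup

variable {G : Type u} [Group G]

theorem relIndex_centralizer_mul_le [Finite G] (A : Subgroup G) (u v : G) :
    (Subgroup.centralizer ({u * v} : Set G)).relIndex A ≤
      (Subgroup.centralizer ({u} : Set G)).relIndex A *
        (Subgroup.centralizer ({v} : Set G)).relIndex A := by
  refine (Subgroup.relIndex_le_of_le_left ?_ ?_).trans Subgroup.relIndex_inf_le
  · intro z hz
    rw [Subgroup.mem_inf, mem_centralizer_singleton, mem_centralizer_singleton] at hz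
    rw [mem_centralizer_singleton]
    exact hz.1.mul_left hz.2
  · exact Subgroup.FiniteIndex.index_ne_zero

theorem relIndex_centralizer_inv (A : Subgroup G) (u : G) :
    (Subgroup.centralizer ({u⁻¹} : Set G)).relIndex A =
      (Subgroup.centralizer ({u} : Set G)).relIndex A := by
  congr 1
  ext y
  simp [mem_centralizer_singleton]

theorem relIndex_centralizer_of_mem {A : Subgroup G} (hA : ∀ x ∈ A, ∀ y ∈ A, Commute x y) {a : G}
    (ha : a ∈ A) : (Subgroup.centralizer ({a} : Set G)).relIndex A = 1 :=
  Subgroup.relIndex_eq_one.2 fun x hx => mem_centralizer_singleton.2 (hA a ha x hx)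

/-- Submultiplicativity applied to `u * a` and to `u = (u * a) * a⁻¹`. Hence the index |A : C_A(u)|
is a function on `G ⧸ A`. -/
theorem relIndex_centralizer_mul_right {A : Subgroup G} [Finite G]
    (hA : ∀ x ∈ A, ∀ y ∈ A, Commute x y) (u : G) {a : G} (ha : a ∈ A) :
    (Subgroup.centralizer ({u * a} : Set G)).relIndex A =
      (Subgroup.centralizer ({u} : Set G)).relIndex A := by
  apply le_antisymm
  · refine (relIndex_centralizer_mul_le A u a).trans_eq ?_
    rw [relIndex_centralizer_of_mem hA ha, mul_one]
  · have h := relIndex_centralizer_mul_le A (u * a) a⁻¹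
    rwa [relIndex_centralizer_of_mem hA (A.inv_mem ha), mul_one, mul_inv_cancel_right] at h

/-- The elements that centralize a subgroup of small index of `A` form a subgroup as soon as there
is a gap in the possible indices. -/
theorem exists_subgroup_relIndex_centralizer_le [Finite G] (A : Subgroup G) {N : ℕ} (hN : 1 ≤ N)
    (hgap : ∀ u : G, (Subgroup.centralizer ({u} : Set G)).relIndex A ≤ N ^ 2 →
      (Subgroup.centralizer ({u} : Set G)).relIndex A ≤ N) :
    ∃ F : Subgroup G, ∀ u, u ∈ F ↔ (Subgroup.centralizer ({u} : Set G)).relIndex A ≤ N := by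
  refine ⟨{ carrier := {u | (Subgroup.centralizer ({u} : Set G)).relIndex A ≤ N}
            mul_mem' := fun {a b} ha hb => hgap _ ((relIndex_centralizer_mul_le A a b).trans
              ((Nat.mul_le_mul ha hb).trans_eq (pow_two N).symm))
            one_mem' := ?_
            inv_mem' := fun {x} hx => (relIndex_centralizer_inv A x).trans_le hx },
          fun x => Iff.rfl⟩
  refine le_trans (le_of_eq (Subgroup.relIndex_eq_one.2 ?_)) hN
  exact fun x _ => mem_centralizer_singleton.2 (Commute.one_left x)

/-- An element of the abelian group `A` that commutes with a transversal of `A` is central, and a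
transversal has at most `m` elements. -/
theorem index_center_le_of_relIndex_centralizer_le [Finite G] {A : Subgroup G}
    (hA : ∀ x ∈ A, ∀ y ∈ A, Commute x y) {m N : ℕ} (hN : 1 ≤ N) (hm : A.index ≤ m)
    (h : ∀ u : G, (Subgroup.centralizer ({u} : Set G)).relIndex A ≤ N) :
    (Subgroup.center G).index ≤ N ^ m * m := by
  classical
  have := Fintype.ofFinite (G ⧸ A)
  let K : Subgroup G := ⨅ q : G ⧸ A, Subgroup.centralizer ({q.out} : Set G)
  have hle : A ⊓ K ≤ Subgroup.center G := by
    intro z hz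
    obtain ⟨hzA, hzK⟩ := Subgroup.mem_inf.1 hz
    rw [Subgroup.mem_center_iff]
    intro g
    obtain ⟨a, ha⟩ := QuotientGroup.mk_out_eq_mul A g
    have h1 := mem_centralizer_singleton.1 (Subgroup.mem_iInf.1 hzK (QuotientGroup.mk g))
    rw [ha] at h1
    have h2 := h1.mul_left (hA _ a.2 z hzA).inv_left
    rw [mul_inv_cancel_right] at h2
    exact h2.eq
  refine (Subgroup.index_le_of_le hle).trans ?_
  rw [← Subgroup.relIndex_mul_index (inf_le_left : A ⊓ K ≤ A), Subgroup.inf_relIndex_left]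
  refine Nat.mul_le_mul ?_ hm
  calc K.relIndex A ≤ ∏ q : G ⧸ A, (Subgroup.centralizer ({q.out} : Set G)).relIndex A :=
        Subgroup.relIndex_iInf_le _
    _ ≤ ∏ _q : G ⧸ A, N := Finset.prod_le_prod' fun q _ => h q.out
    _ = N ^ A.index := by
      rw [Finset.prod_const, Finset.card_univ, ← Nat.card_eq_fintype_card]; rfl
    _ ≤ N ^ m := Nat.pow_le_pow_right hN hm

theorem index_center_subgroup_le [Finite G] {A F : Subgroup G}
    (hA : ∀ x ∈ A, ∀ y ∈ A, Commute x y) (hAF : A ≤ F) {m N : ℕ} (hN : 1 ≤ N) (hm : A.index ≤ m)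
    (h : ∀ u ∈ F, (Subgroup.centralizer ({u} : Set G)).relIndex A ≤ N) :
    (Subgroup.center F).index ≤ N ^ m * m := by
  refine index_center_le_of_relIndex_centralizer_le (A := A.subgroupOf F) ?_ hN
    ((Subgroup.relIndex_le_index A F).trans hm) fun u => ?_
  · intro x hx y hy
    exact Subtype.ext (hA x hx y hy).eq
  · have : Subgroup.centralizer ({u} : Set F) =
        (Subgroup.centralizer ({(u : G)} : Set G)).subgroupOf F := by
      ext y
      rw [Subgroup.mem_subgroupOf, mem_centralizer_singleton, mem_centralizer_singleton]
      simp [Commute, SemiconjBy, Subtype.ext_iff]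
    rw [this, Subgroup.relIndex_subgroupOf hAF]
    exact h u u.2

/-- If all elements outside `F` have large conjugacy classes, then almost all commuting pairs lie
in `F`. -/
theorem commProb_le_of_centIndex_ge [Finite G] (F : Subgroup G) {N : ℕ} (hN : 1 ≤ N)
    (h : ∀ u ∉ F, N ≤ centIndex u) :
    (commProb G : ℝ) ≤ commProb F / (F.index : ℝ) ^ 2 + 2 / N := by
  classical
  have := Fintype.ofFinite G
  have hN0 : (0 : ℝ) < N := by exact_mod_cast hN
  have hF0 : (0 : ℝ) < Nat.card F := Nat.cast_pos.2 Nat.card_pos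
  have hI0 : (0 : ℝ) < F.index := by
    exact_mod_cast Nat.pos_of_ne_zero Subgroup.FiniteIndex.index_ne_zero
  have hcard : (Nat.card G : ℝ) = Nat.card F * F.index := by exact_mod_cast F.card_mul_index.symm
  have hG0 : (0 : ℝ) < Nat.card G := Nat.cast_pos.2 Nat.card_pos
  -- Commuting pairs with first entry outside `F`. A pair not in `F × F` is counted by `X` directly
  -- or after swapping its entries.
  let X := Σ u : {u : G // u ∉ F}, Subgroup.centralizer ({(u : G)} : Set G)
  have hX : (Nat.card X : ℝ) ≤ Nat.card G * (Nat.card G / N) := by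
    rw [Nat.card_sigma]
    push_cast
    calc _ ≤ ∑ _u : {u : G // u ∉ F}, (Nat.card G / N : ℝ) := by
          refine Finset.sum_le_sum fun u _ => ?_
          rw [le_div_iff₀ hN0]
          have h1 := card_centralizer_mul_centIndex (u : G)
          exact_mod_cast (Nat.mul_le_mul_left _ (h u u.2)).trans_eq h1
      _ ≤ _ := by
          rw [Finset.sum_const, nsmul_eq_mul, Finset.card_univ, ← Nat.card_eq_fintype_card]
          gcongr
          exact Finite.card_subtype_le _
  have hle : Nat.card {p : G × G // Commute p.1 p.2} ≤
      Nat.card {p : F × F // Commute p.1 p.2} + (Nat.card X + Nat.card X) := by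
    rw [← Nat.card_sum, ← Nat.card_sum]
    refine Nat.card_le_card_of_surjective (Sum.elim
      (fun p => ⟨(p.1.1, p.1.2), congrArg Subtype.val p.2.eq⟩) (Sum.elim
        (fun s => ⟨(s.1, s.2), mem_centralizer_singleton.1 s.2.2⟩)
        (fun s => ⟨(s.2, s.1), (mem_centralizer_singleton.1 s.2.2).symm⟩))) ?_
    rintro ⟨⟨u, v⟩, huv⟩
    by_cases hu : u ∈ F
    · by_cases hv : v ∈ F
      · exact ⟨Sum.inl ⟨(⟨u, hu⟩, ⟨v, hv⟩), Subtype.ext huv.eq⟩, rfl⟩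
      · exact ⟨Sum.inr (Sum.inr ⟨⟨v, hv⟩, ⟨u, mem_centralizer_singleton.2 huv.symm⟩⟩), rfl⟩
    · exact ⟨Sum.inr (Sum.inl ⟨⟨u, hu⟩, ⟨v, mem_centralizer_singleton.2 huv⟩⟩), rfl⟩
  have hle' : (Nat.card {p : G × G // Commute p.1 p.2} : ℝ) ≤
      Nat.card {p : F × F // Commute p.1 p.2} + 2 * (Nat.card G * (Nat.card G / N)) := by
    have : (Nat.card {p : G × G // Commute p.1 p.2} : ℝ) ≤
        Nat.card {p : F × F // Commute p.1 p.2} + (Nat.card X + Nat.card X) := by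
      exact_mod_cast hle
    linarith
  rw [commProb_def, commProb_def]
  push_cast
  rw [div_le_iff₀ (by positivity)]
  refine hle'.trans (le_of_eq ?_)
  rw [hcard]
  field_simp

theorem commProb_subgroup_div_le [Finite G] (F : Subgroup G) :
    (commProb F : ℝ) / (F.index : ℝ) ^ 2 ≤ commProb G := by
  have hI0 : (0 : ℝ) < F.index := by
    exact_mod_cast Nat.pos_of_ne_zero Subgroup.FiniteIndex.index_ne_zero
  rw [div_le_iff₀ (by positivity)]
  exact_mod_cast F.commProb_subgroup_le

end AbelianSubgroup

/-! ### Limits of commuting probabilities along an ultrafilter -/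

theorem Ultrafilter.exists_eventually_eq_of_mem_finite {α β : Type*} (U : Ultrafilter α) {f : α → β}
    {s : Set β} (hs : s.Finite) (h : ∀ᶠ i in U, f i ∈ s) : ∃ b ∈ s, ∀ᶠ i in U, f i = b :=
  (Ultrafilter.eventually_exists_mem_iff hs).1 (h.mono fun i hi => ⟨f i, hi, rfl⟩)

theorem Ultrafilter.exists_eventually_eq_of_le {α : Type*} (U : Ultrafilter α) {f : α → ℕ} {m : ℕ}
    (h : ∀ᶠ i in U, f i ≤ m) : ∃ b ≤ m, ∀ᶠ i in U, f i = b :=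
  U.exists_eventually_eq_of_mem_finite (Set.finite_Iic m) h

/-- Along `U`, the commuting probabilities of the groups `G i` converge from above to `1 / k` times
a commuting probability, and they are eventually constant if `k = 1`. -/
def HasCommProbLimit (U : Filter ℕ) (G : ℕ → Type u) [∀ i, Group (G i)] : Prop :=
  ∃ (H : Type u) (_ : Group H) (_ : Finite H) (k : ℕ), 1 ≤ k ∧
    Tendsto (fun i => (commProb (G i) : ℝ)) U (𝓝 ((1 / (k : ℝ)) * (commProb H : ℝ))) ∧
    (∀ᶠ i in U, (1 / (k : ℝ)) * (commProb H : ℝ) ≤ (commProb (G i) : ℝ)) ∧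
    (2 ≤ k ∨ ∃ c, ∀ᶠ i in U, commProb (G i) = c)

/-- Along an ultrafilter, a bounded count `t N i` that increases in `N` stops increasing. -/
theorem Ultrafilter.exists_forall_eventually_eq (U : Ultrafilter ℕ) {t : ℕ → ℕ → ℕ} {m : ℕ}
    (hm : ∀ᶠ i in U, ∀ N, t N i ≤ m) (hmono : ∀ i, Monotone fun N => t N i) :
    ∃ N₀, ∀ N, N₀ ≤ N → ∀ᶠ i in U, t N i = t N₀ i := by
  choose T hTm hT using fun N =>
    U.exists_eventually_eq_of_le (f := t N) (hm.mono fun i hi => hi N)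
  obtain ⟨N₀, hN₀⟩ : ∃ N₀, ∀ N, T N ≤ T N₀ := by
    have hb : BddAbove (Set.range T) := ⟨m, by rintro _ ⟨N, rfl⟩; exact hTm N⟩
    obtain ⟨N₀, h⟩ := Nat.sSup_mem (Set.range_nonempty T) hb
    exact ⟨N₀, fun N => h ▸ le_csSup hb ⟨N, rfl⟩⟩
  refine ⟨N₀, fun N hN => ?_⟩
  filter_upwards [hT N, hT N₀] with i h1 h2
  exact le_antisymm (h1 ▸ h2 ▸ hN₀ N) (hmono i hN)

/-- Finite groups with an abelian subgroup of bounded index. -/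
theorem hasCommProbLimit_of_abelian (U : Ultrafilter ℕ) (G : ℕ → Type u) [∀ i, Group (G i)]
    [∀ i, Finite (G i)] (A : ∀ i, Subgroup (G i)) (m : ℕ)
    (hA : ∀ᶠ i in U, (A i).index ≤ m ∧ ∀ x ∈ A i, ∀ y ∈ A i, Commute x y) :
    HasCommProbLimit U G := by
  classical
  let s : ∀ i, G i → ℕ := fun i u => (Subgroup.centralizer ({u} : Set (G i))).relIndex (A i)
  -- Counts the cosets of `A i` with centralizer index at most `N + 1`; the shift keeps the
  -- threshold at least 1, the value at the identity.
  let t : ℕ → ℕ → ℕ := fun N i => Nat.card {q : G i ⧸ A i // s i q.out ≤ N + 1}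
  obtain ⟨N₀, hN₀⟩ := U.exists_forall_eventually_eq (t := t) (m := m)
    (hA.mono fun i hi N => (Finite.card_subtype_le _).trans hi.1)
    (fun i N N' h => Nat.card_le_card_of_injective
      (fun q : {q : G i ⧸ A i // s i q.out ≤ N + 1} =>
        (⟨q.1, q.2.trans (by omega)⟩ : {q : G i ⧸ A i // s i q.out ≤ N' + 1}))
      (fun q r hqr => Subtype.ext (Subtype.mk.inj hqr)))
  -- Once the count stops growing, no index lies strictly above `N₀ + 1` and at most `N + 1`. With
  -- `N + 1` past the square of `N₀ + 1`, this gap makes the elements of small index a subgroup.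
  have hgap : ∀ N, N₀ ≤ N → ∀ᶠ i in U, ∀ u, s i u ≤ N + 1 → s i u ≤ N₀ + 1 := by
    intro N hN
    filter_upwards [hN₀ N hN, hA] with i hi hAi u hu
    have hout : s i (QuotientGroup.mk u : G i ⧸ A i).out = s i u := by
      obtain ⟨a, ha⟩ := QuotientGroup.mk_out_eq_mul (A i) u
      rw [ha]
      exact relIndex_centralizer_mul_right hAi.2 u a.2
    let φ : {q : G i ⧸ A i // s i q.out ≤ N₀ + 1} → {q : G i ⧸ A i // s i q.out ≤ N + 1} :=
      fun q => ⟨q.1, q.2.trans (by omega)⟩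
    have hφ : Function.Injective φ := fun q r hqr => Subtype.ext (Subtype.mk.inj hqr)
    obtain ⟨q, hq⟩ := (hφ.bijective_of_nat_card_le hi.le).2 ⟨QuotientGroup.mk u, hout.trans_le hu⟩
    have h1 := q.2
    rw [show q.1 = QuotientGroup.mk u from congrArg Subtype.val hq, hout] at h1
    exact h1
  have hF : ∀ i, ∃ F : Subgroup (G i), (∀ u, s i u ≤ (N₀ + 1) ^ 2 → s i u ≤ N₀ + 1) →
      ∀ u, u ∈ F ↔ s i u ≤ N₀ + 1 := by
    intro i
    by_cases h : ∀ u, s i u ≤ (N₀ + 1) ^ 2 → s i u ≤ N₀ + 1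
    · obtain ⟨F, hF⟩ := exists_subgroup_relIndex_centralizer_le (A i) (by omega) h
      exact ⟨F, fun _ => hF⟩
    · exact ⟨⊤, fun h' => absurd h' h⟩
  choose F hF using hF
  have hFmem : ∀ᶠ i in U, ∀ u, u ∈ F i ↔ s i u ≤ N₀ + 1 := by
    filter_upwards [hgap ((N₀ + 1) ^ 2) (by nlinarith)] with i hi
    exact hF i fun u hu => hi u (by omega)
  have hAF : ∀ᶠ i in U, A i ≤ F i := by
    filter_upwards [hA, hFmem] with i hAi hFi a ha
    rw [hFi]
    exact (relIndex_centralizer_of_mem hAi.2 ha).trans_le (by omega)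
  obtain ⟨d, -, hd⟩ := U.exists_eventually_eq_of_le (f := fun i => (F i).index) (m := m) (by
    filter_upwards [hA, hAF] with i hAi hAFi
    exact (Subgroup.index_le_of_le hAFi).trans hAi.1)
  have hd1 : 1 ≤ d := by
    obtain ⟨i, hi⟩ := hd.exists
    rw [← hi]
    exact Nat.pos_of_ne_zero Subgroup.FiniteIndex.index_ne_zero
  -- The center of `F i` has bounded index, so its commuting probability lies in a finite set of
  -- fractions.
  obtain ⟨c, -, hc⟩ := U.exists_eventually_eq_of_mem_finite
    (f := fun i => (commProb (F i) : ℝ))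
    (s := Set.image2 (fun j n : ℕ => (j : ℝ) / (n : ℝ) ^ 2)
      (Set.Iic (((N₀ + 1) ^ m * m) ^ 2)) (Set.Iic ((N₀ + 1) ^ m * m)))
    ((Set.finite_Iic _).image2 _ (Set.finite_Iic _)) (by
      filter_upwards [hA, hAF, hFmem] with i hAi hAFi hFi
      obtain ⟨j, hj, hP⟩ := exists_commProb_eq_div_index_center_sq (F i)
      have hcen := index_center_subgroup_le hAi.2 hAFi (N := N₀ + 1) (by omega) hAi.1
        (fun u hu => (hFi u).1 hu)
      exact ⟨j, hj.trans (Nat.pow_le_pow_left hcen 2), _, hcen, hP.symm⟩)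
  obtain ⟨i₀, hi₀⟩ := hc.exists
  have hlow : ∀ᶠ i in U, (1 / ((d ^ 2 : ℕ) : ℝ)) * (commProb (F i₀) : ℝ) ≤ commProb (G i) := by
    filter_upwards [hc, hd] with i hci hdi
    have h := commProb_subgroup_div_le (F i)
    rw [hdi, hci] at h
    rw [hi₀]
    push_cast
    rwa [one_div_mul_eq_div]
  have hup : ∀ N : ℕ, N₀ ≤ N → ∀ᶠ i in U, (commProb (G i) : ℝ) ≤
      (1 / ((d ^ 2 : ℕ) : ℝ)) * (commProb (F i₀) : ℝ) + 2 / ((N + 1 : ℕ) : ℝ) := by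
    intro N hN
    filter_upwards [hc, hd, hFmem, hgap N hN] with i hci hdi hFi hgi
    have h := commProb_le_of_centIndex_ge (F i) (N := N + 1) (by omega) (fun u hu => by
      rw [hFi] at hu
      by_contra hlt
      exact hu (hgi u ((Subgroup.relIndex_le_index _ _).trans (not_le.1 hlt).le)))
    rw [hdi, hci] at h
    rw [hi₀]
    push_cast at h ⊢
    rwa [one_div_mul_eq_div]
  refine ⟨F i₀, inferInstance, inferInstance, d ^ 2, Nat.one_le_pow _ _ hd1, ?_, hlow, ?_⟩
  · rw [Metric.tendsto_nhds]
    intro ε hε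
    obtain ⟨N, hN⟩ := exists_nat_gt (2 / ε)
    have hlt : 2 / ((N₀ + N + 1 : ℕ) : ℝ) < ε := by
      have h0 : (0 : ℝ) < ((N₀ + N + 1 : ℕ) : ℝ) := by positivity
      rw [div_lt_iff₀ hε] at hN
      rw [div_lt_iff₀ h0]
      push_cast
      nlinarith [Nat.cast_nonneg (α := ℝ) N₀]
    filter_upwards [hlow, hup (N₀ + N) (by omega)] with i h1 h2
    rw [Real.dist_eq, abs_lt]
    constructor <;> linarith
  · rcases hd1.eq_or_lt with h | h
    · right
      refine ⟨commProb (F i₀), ?_⟩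
      filter_upwards [hc, hd] with i hci hdi
      rw [← h, Subgroup.index_eq_one] at hdi
      have h1 : commProb (F i) = commProb (G i) := by
        rw [hdi]
        exact commProb_congr Subgroup.topEquiv
      rw [← h1]
      exact_mod_cast hci.trans hi₀.symm
    · left
      nlinarith

/-- Finite groups with a normal subgroup of bounded index and of class at most two whose commutator
subgroup has bounded order. -/
theorem hasCommProbLimit_of_class_two (U : Ultrafilter ℕ) (G : ℕ → Type u) [∀ i, Group (G i)]
    [∀ i, Finite (G i)] (A : ∀ i, Subgroup (G i)) (m c : ℕ)
    (hA : ∀ᶠ i in U, (A i).Normal ∧ (A i).index ≤ m ∧ Nat.card (⁅A i, A i⁆ : Subgroup (G i)) ≤ c ∧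
      A i ≤ Subgroup.centralizer (⁅A i, A i⁆ : Subgroup (G i))) :
    HasCommProbLimit U G := by
  classical
  induction c using Nat.strong_induction_on generalizing A m with
  | _ c ih =>
  by_cases hred : ∃ m' : ℕ, ∀ᶠ i in U, ∃ B : Subgroup (G i), B.Normal ∧ B ≤ A i ∧ B.index ≤ m' ∧
      ⁅B, B⁆ < ⁅A i, A i⁆
  · obtain ⟨m', hB⟩ := hred
    have hB' : ∀ i, ∃ B : Subgroup (G i), (∃ B : Subgroup (G i), B.Normal ∧ B ≤ A i ∧
        B.index ≤ m' ∧ ⁅B, B⁆ < ⁅A i, A i⁆) → B.Normal ∧ B ≤ A i ∧ B.index ≤ m' ∧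
        ⁅B, B⁆ < ⁅A i, A i⁆ := fun i => by
      by_cases h : ∃ B : Subgroup (G i), B.Normal ∧ B ≤ A i ∧ B.index ≤ m' ∧ ⁅B, B⁆ < ⁅A i, A i⁆
      · obtain ⟨B, hB⟩ := h
        exact ⟨B, fun _ => hB⟩
      · exact ⟨⊤, fun h' => absurd h' h⟩
    choose B hB' using hB'
    obtain ⟨i, hi, hAi⟩ := (hB.and hA).exists
    have hcard : ∀ i, ⁅B i, B i⁆ < ⁅A i, A i⁆ →
        Nat.card (⁅B i, B i⁆ : Subgroup (G i)) < Nat.card (⁅A i, A i⁆ : Subgroup (G i)) :=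
      fun i h => by
        refine lt_of_le_of_ne (Subgroup.card_le_of_le h.le) fun heq => ?_
        exact h.ne (Subgroup.eq_of_le_of_card_ge h.le heq.ge)
    have hc1 : 1 ≤ c := (Nat.card_pos).trans_le hAi.2.2.1
    refine ih (c - 1) (by omega) B m' ?_
    filter_upwards [hB, hA] with i hBi hAi
    obtain ⟨h1, h2, h3, h4⟩ := hB' i hBi
    have := hcard i h4
    refine ⟨h1, h3, by omega, h2.trans (hAi.2.2.2.trans (Subgroup.centralizer_le h4.le))⟩
  -- The negation passes through the ultrafilter: for each fixed `m'`, almost every `G i` has no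
  -- such `B`, so the dichotomy must give its first alternative, with `r` arbitrary.
  · have hred' : ∀ m' : ℕ, ∀ᶠ i in U, ¬ ∃ B : Subgroup (G i), B.Normal ∧ B ≤ A i ∧ B.index ≤ m' ∧
        ⁅B, B⁆ < ⁅A i, A i⁆ := fun m' => by
      rw [Ultrafilter.eventually_not]
      exact fun h => hred ⟨m', h⟩
    -- Normality holds only eventually, but the quotients must be groups for every `i`; the default
    -- is `⊤`.
    have hN : ∃ A' : ∀ i, Subgroup (G i), (∀ i, (A' i).Normal) ∧ ∀ᶠ i in U, A' i = A i := by
      refine ⟨fun i => if (A i).Normal then A i else ⊤, fun i => ?_, ?_⟩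
      · dsimp only
        split_ifs with h
        · exact h
        · infer_instance
      · filter_upwards [hA] with i hi
        exact if_pos hi.1
    obtain ⟨A', hA'n, hA'⟩ := hN
    let L : ∀ i, Subgroup (G i) := fun i => ⁅A' i, A' i⁆
    obtain ⟨l, -, hl⟩ := U.exists_eventually_eq_of_le (f := fun i => Nat.card (L i)) (m := c) (by
      filter_upwards [hA, hA'] with i hi hi'
      change Nat.card (⁅A' i, A' i⁆ : Subgroup (G i)) ≤ c
      rw [hi']
      exact hi.2.2.1)
    have hl1 : 1 ≤ l := by
      obtain ⟨i, hi⟩ := hl.exists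
      rw [← hi]
      exact Nat.card_pos
    rcases hl1.eq_or_lt with hl0 | hl2
    · refine hasCommProbLimit_of_abelian U G A' m ?_
      filter_upwards [hA, hA', hl] with i hi hi' hli
      refine ⟨hi' ▸ hi.2.1, fun x hx y hy => ?_⟩
      rw [← hl0, Subgroup.card_eq_one] at hli
      have h1 : ⁅x, y⁆ ∈ L i := Subgroup.commutator_mem_commutator hx hy
      rw [hli, Subgroup.mem_bot] at h1
      exact commutatorElement_eq_one_iff_commute.1 h1
    · obtain ⟨H, _, _, k, hk, hlim, hlow, -⟩ := hasCommProbLimit_of_abelian U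
        (fun i => G i ⧸ L i) (fun i => (A' i).map (QuotientGroup.mk' (L i))) m (by
          filter_upwards [hA, hA'] with i hi hi'
          constructor
          · refine le_trans (Nat.le_of_dvd (Nat.pos_of_ne_zero Subgroup.FiniteIndex.index_ne_zero)
              (Subgroup.index_map_dvd _ (QuotientGroup.mk'_surjective (L i)))) (hi' ▸ hi.2.1)
          · rintro _ ⟨x, hx, rfl⟩ _ ⟨y, hy, rfl⟩
            rw [← commutatorElement_eq_one_iff_commute, ← map_commutatorElement]
            exact (QuotientGroup.eq_one_iff _).2 (Subgroup.commutator_mem_commutator hx hy))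
      have hl0 : (0 : ℝ) < l := by exact_mod_cast hl1
      have hlow' : ∀ᶠ i in U, 1 / (l : ℝ) * (commProb (G i ⧸ L i) : ℝ) ≤ commProb (G i) := by
        filter_upwards [hl] with i hli
        have h := (L i).commProb_quotient_le
        rw [hli] at h
        rw [one_div_mul_eq_div, div_le_iff₀ hl0]
        exact_mod_cast h
      have hup : ∀ r : ℕ, 1 ≤ r → ∀ᶠ i in U, (commProb (G i) : ℝ) ≤
          1 / (l : ℝ) * (commProb (G i ⧸ L i) : ℝ) + 2 / r := by
        intro r hr
        filter_upwards [hl, hA, hA', hred' (2 ^ c * m * r * r).factorial] with i hli hi hi' hri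
        rw [← hi'] at hi hri
        rcases commProb_le_or_exists_normal_lt hi.2.2.2 hr hi.2.1 hi.2.2.1 with h | h
        · rw [one_div_mul_eq_div, ← hli]
          exact h
        · exact absurd h hri
      have hdiff : Tendsto (fun i => (commProb (G i) : ℝ) - 1 / (l : ℝ) * (commProb (G i ⧸ L i) : ℝ))
          U (𝓝 0) := by
        rw [Metric.tendsto_nhds]
        intro ε hε
        obtain ⟨r, hr⟩ := exists_nat_gt (2 / ε)
        have hlt : 2 / ((r + 1 : ℕ) : ℝ) < ε := by
          have h0 : (0 : ℝ) < ((r + 1 : ℕ) : ℝ) := by positivity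
          rw [div_lt_iff₀ hε] at hr
          rw [div_lt_iff₀ h0]
          push_cast
          nlinarith
        filter_upwards [hlow', hup (r + 1) (by omega)] with i h1 h2
        rw [Real.dist_eq, abs_lt]
        constructor <;> linarith
      have heq : (1 / ((l * k : ℕ) : ℝ)) * (commProb H : ℝ) =
          1 / (l : ℝ) * (1 / (k : ℝ) * (commProb H : ℝ)) := by
        push_cast
        rw [← mul_assoc, one_div_mul_one_div]
      -- Here `l ≥ 2`, so `l * k ≥ 2` even if the quotient groups gave `k = 1`.
      refine ⟨H, inferInstance, inferInstance, l * k, by nlinarith, ?_, ?_, Or.inl (by nlinarith)⟩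
      · rw [heq]
        have h := hdiff.add (hlim.const_mul (1 / (l : ℝ)))
        simpa using h
      · filter_upwards [hlow, hlow'] with i h1 h2
        rw [heq]
        exact le_trans (by gcongr) h2

/-! ### From the ultrafilter to a subsequence -/

theorem mainTheorem2
    (G : ℕ → Type u) [∀ i, Group (G i)] [∀ i, Finite (G i)]
    (hG : ∃ ε : ℝ, 0 < ε ∧ ∀ i, ε ≤ (commProb (G i) : ℝ)) :
    ∃ n : ℕ → ℕ, StrictMono n ∧
      ((∀ i j, commProb (G (n i)) = commProb (G (n j))) ∨
        ∃ (H : Type u) (_ : Group H) (_ : Finite H) (k : ℕ), 2 ≤ k ∧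
          Tendsto (fun i => (commProb (G (n i)) : ℝ)) atTop
            (𝓝 ((1 / (k : ℝ)) * (commProb H : ℝ))) ∧
          ∀ i, (1 / (k : ℝ)) * (commProb H : ℝ) ≤ (commProb (G (n i)) : ℝ)) := by
  obtain ⟨ε, hε, hG⟩ := hG
  obtain ⟨m, c, h⟩ := exists_normal_of_le_commProb.{u} hε
  choose A hA using fun i => h (G i) (hG i)
  let U : Ultrafilter ℕ := hyperfilter ℕ
  have hU : (U : Filter ℕ) ≤ atTop := Nat.hyperfilter_le_atTop
  obtain ⟨H, _, _, k, -, hlim, hlow, hk⟩ :=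
    hasCommProbLimit_of_class_two U G A m c (Eventually.of_forall hA)
  rcases hk with hk | ⟨q, hq⟩
  -- Sets in a nonprincipal ultrafilter are infinite, so a strictly increasing choice of indices can
  -- put the `n`-th term within 1/(n+1) above the limit.
  · have hfreq : ∀ n : ℕ, ∃ᶠ i in atTop,
        1 / (k : ℝ) * (commProb H : ℝ) ≤ (commProb (G i) : ℝ) ∧
        (commProb (G i) : ℝ) < 1 / (k : ℝ) * (commProb H : ℝ) + 1 / ((n : ℝ) + 1) := by
      intro n
      refine Frequently.filter_mono (Eventually.frequently ?_) hU
      refine hlow.and (hlim.eventually_lt_const ?_)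
      linarith [Nat.one_div_pos_of_nat (α := ℝ) (n := n)]
    obtain ⟨n, hn, hn'⟩ := extraction_forall_of_frequently hfreq
    refine ⟨n, hn, Or.inr ⟨H, inferInstance, inferInstance, k, hk, ?_, fun i => (hn' i).1⟩⟩
    refine tendsto_of_tendsto_of_tendsto_of_le_of_le tendsto_const_nhds ?_
      (fun i => (hn' i).1) (fun i => (hn' i).2.le)
    simpa using tendsto_one_div_add_atTop_nhds_zero_nat (𝕜 := ℝ) |>.const_add
      (1 / (k : ℝ) * (commProb H : ℝ))
  · obtain ⟨n, hn, hn'⟩ := extraction_of_frequently_atTop (hq.frequently.filter_mono hU)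
    exact ⟨n, hn, Or.inl fun i j => (hn' i).trans (hn' j).symm⟩
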